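/- Let $H$ be a separable infinite-dimensional complex Hilbert space, $K(H)$ the algebra of compact operators on $H$ and $K(H)^+$ the set of positive ones. For $a \in K(H)^+$ let $\lambda_1(a) \ge \lambda_2(a) \ge \cdots$ be the list of the nonzero eigenvalues of $a$ in decreasing order, counted with multiplicity, continued by zeros if $a$ has finite rank. Let $\alpha : \{0,1,2,\dots\} \to [0,\infty)$ be an increasing (not necessarily strictly) function with $\alpha(0) = 0$ and $\alpha(1) > 0$, and put $c_i = \alpha(i) - \alpha(i-1)$ for $i \ge 1$. Define $\varphi_\alpha : K(H)^+ \to [0,\infty]$ by $$\varphi_\alpha(a) = \sum_{i=1}^\infty (\lambda_i(a) - \lambda_{i+1}(a))\,\alpha(i),$$ and for $a \in K(H)$ put $|||a|||_\alpha = \varphi_\alpha(|a|) \in [0,\infty]$, where $|a| = (a^*a)^{1/2}$. Then the following conditions are equivalent: 1. $\alpha$ is concave, in the sense that $\frac{\alpha(i+1) + \alpha(i-1)}{2} \le \alpha(i)$ for all $i = 1, 2, 3, \dots$; 2. $(c_i)_{i \ge 1}$ is decreasing: $c_1 \ge c_2 \ge c_3 \ge \cdots$; 3. $|||\cdot|||_\alpha$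 satisfies the triangle inequality: $|||a+b|||_\alpha \le |||a|||_\alpha + |||b|||_\alpha$ in $[0,\infty]$ for all $a, b \in K(H)$. -/

import Mathlib

open scoped ENNReal NNReal

noncomputable section

namespace ChoquetTrace

variable {H : Type*} [NormedAddCommGroup H] [InnerProductSpace ℂ H] [CompleteSpace H]

/-- The linear span of the eigenspaces of `a` for real eigenvalues `s ≥ t`.  Its dimension
is the number of eigenvalues of `a` that are at least `t`, counted with multiplicity. -/
def upperEigenspace (a : H →L[ℂ] H) (t : ℝ) : Submodule ℂ H :=
  ⨆ s : ℝ, ⨆ _ : t ≤ s, Module.End.eigenspace (a : H →ₗ[ℂ] H) (s : ℂ)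

/-- The eigenvalue sequence of a positive compact operator `a`: `eigenvalueSeq a k` is
`λ_{k+1}(a)`, the `(k+1)`-st largest eigenvalue of `a` counted with multiplicity, the list being
continued by zeros when `a` has finite rank.  It is the largest `t ≥ 0` such that `a` has at least
`k + 1` eigenvalues (with multiplicity) in `[t, ∞)`. -/
def eigenvalueSeq (a : H →L[ℂ] H) (k : ℕ) : ℝ :=
  sSup {t : ℝ | 0 ≤ t ∧ ((k + 1 : ℕ) : Cardinal) ≤ Module.rank ℂ (upperEigenspace a t)}

/-- The non-linear trace of Choquet type associated with `α`, on positive compact operators: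
`φ_α(a) = ∑_{i ≥ 1} (λ_i(a) - λ_{i+1}(a)) α(i)`, with values in `[0, ∞]`
(the term of index `k` below is the one with `i = k + 1`). -/
def choquetTrace (α : ℕ → ℝ≥0) (a : H →L[ℂ] H) : ℝ≥0∞ :=
  ∑' k : ℕ, ENNReal.ofReal (eigenvalueSeq a k - eigenvalueSeq a (k + 1)) * (α (k + 1) : ℝ≥0∞)

/-- `|||a|||_α = φ_α(|a|)`, where `|a| = (a* a)^{1/2}`, for compact `a`. -/
def choquetNorm (α : ℕ → ℝ≥0) (a : H →L[ℂ] H) : ℝ≥0∞ :=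
  choquetTrace α (CFC.abs a)

/-- Midpoint concavity: `(α(i+1) + α(i-1)) / 2 ≤ α(i)` for `i = 1, 2, 3, …`. -/
def IsConcaveSeq (α : ℕ → ℝ≥0) : Prop :=
  ∀ i : ℕ, 1 ≤ i → ((α (i + 1) : ℝ) + (α (i - 1) : ℝ)) / 2 ≤ (α i : ℝ)

/-- The increments `c_i = α(i) - α(i-1)`, meant for `i ≥ 1`. -/
def increment (α : ℕ → ℝ≥0) (i : ℕ) : ℝ :=
  (α i : ℝ) - (α (i - 1) : ℝ)

end ChoquetTrace

end

set_option linter.unusedSectionVars false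

noncomputable section

namespace ChoquetTrace

variable {H : Type*} [NormedAddCommGroup H] [InnerProductSpace ℂ H] [CompleteSpace H]

/-! Summation by parts (`tsum_sub_mul_eq`) turns `φ_α(|a|)` into `∑ c_i λ_i(|a|)`, a weighted sum of
singular values.

If `c` decreases, Abel summation (`tsum_mul_le_of_sum_le`) reduces the triangle inequality to that
for the Ky Fan sums `λ_1 + ⋯ + λ_n`. Such a sum is the maximum of `Re ∑ ⟨u_k, a v_k⟩` over
orthogonal families in the unit ball, hence subadditive in `a`: `re_sum_inner_le` is the bound,
`sum_inner_polarSeq` its attainment.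

Conversely, two commuting projections of rank `n + 1` whose ranges meet in dimension `n` have a sum
with eigenvalues `2` (`n` times) and `1` (twice). The triangle inequality for them reads `α(n) +
α(n+2) ≤ 2 α(n+1)`.

Eigenvalue lists are handled through `IsEigenSequence`; `eigenvalueSeq_eq` ties them to the
definition by ranks. -/

/-! ### The modulus of a compact operator -/

theorem inner_abs_abs (a : H →L[ℂ] H) (x y : H) :
    inner ℂ (CFC.abs a x) (CFC.abs a y) = inner ℂ (a x) (a y) := by
  have hpos := (ContinuousLinearMap.nonneg_iff_isPositive _).1 (CFC.abs_nonneg a)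
  have h := congrArg (fun T : H →L[ℂ] H => T y) (CFC.abs_mul_abs a)
  simp only [mul_apply_eq_comp] at h
  rw [hpos.inner_left_eq_inner_right, h, ContinuousLinearMap.star_eq_adjoint,
    ContinuousLinearMap.adjoint_inner_right]

theorem norm_abs_apply (a : H →L[ℂ] H) (x : H) : ‖CFC.abs a x‖ = ‖a x‖ := by
  rw [@norm_eq_sqrt_re_inner ℂ, @norm_eq_sqrt_re_inner ℂ, inner_abs_abs]

/-- Compactness passes to an operator dominated in norm. -/
theorem isCompactOperator_of_norm_apply_le {a b : H →L[ℂ] H} (ha : IsCompactOperator a)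
    (hab : ∀ x, ‖b x‖ ≤ ‖a x‖) : IsCompactOperator b := by
  have h1 : TotallyBounded (a '' Metric.ball 0 1) :=
    ((IsCompactOperator.isCompact_closure_image_ball (f := (a : H →ₗ[ℂ] H)) ha
      1).totallyBounded).subset subset_closure
  refine (isCompactOperator_iff_isCompact_closure_image_ball (b : H →ₗ[ℂ] H) one_pos).2 ?_
  refine TotallyBounded.isCompact_of_isClosed (TotallyBounded.closure ?_) isClosed_closure
  rw [Metric.totallyBounded_iff]
  intro ε hε
  -- The centres are taken inside the image, so they lift to points `z` of the ball, and the points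
  -- `b z` form an `ε`-net for `b`.
  obtain ⟨t, hts, htf, ht⟩ := Metric.finite_approx_of_totallyBounded h1 ε hε
  obtain ⟨s, hs, hsf, rfl⟩ := Set.exists_subset_image_finite_and.1 ⟨t, hts, htf, rfl⟩
  refine ⟨b '' s, hsf.image _, ?_⟩
  rintro _ ⟨x, hx, rfl⟩
  obtain ⟨y, hy, hxy⟩ := Set.mem_iUnion₂.1 (ht ⟨x, hx, rfl⟩)
  obtain ⟨z, hz, rfl⟩ := hy
  refine Set.mem_iUnion₂.2 ⟨b z, ⟨z, hz, rfl⟩, ?_⟩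
  rw [Metric.mem_ball, dist_eq_norm] at hxy ⊢
  have := hab (x - z)
  simp only [map_sub] at this
  exact this.trans_lt hxy

theorem isCompactOperator_abs {a : H →L[ℂ] H} (ha : IsCompactOperator a) :
    IsCompactOperator (CFC.abs a : H →L[ℂ] H) :=
  isCompactOperator_of_norm_apply_le (a := a) (b := CFC.abs a) ha
    fun x => (norm_abs_apply a x).le

/-! ### Eigenvalue lists of positive compact operators -/

/-- `e` lists orthonormal eigenvectors of `A` by decreasing eigenvalues `μ`, exhausting the
spectrum of `A` from above. -/
structure IsEigenSequence (A : H →L[ℂ] H) (e : ℕ → H) (μ : ℕ → ℝ) : Prop where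
  orthonormal : Orthonormal ℂ e
  nonneg : ∀ n, 0 ≤ μ n
  apply_eq : ∀ n, A (e n) = (μ n : ℂ) • e n
  norm_le : ∀ n w, (∀ j < n, inner ℂ (e j) w = 0) → ‖A w‖ ≤ μ n * ‖w‖

/-- The compression `B` of `A` to `Vᗮ` is positive and compact, so `‖B‖` is in its spectrum and, if
nonzero, is an eigenvalue. Its eigenvectors lie in the range of `B`, hence in `Vᗮ`, where `B` agrees
with `A`. -/
theorem exists_eigenvector_orthogonal (hH : ¬ FiniteDimensional ℂ H) {A : H →L[ℂ] H}
    (hA : IsCompactOperator A) (hpos : A.IsPositive) (V : Submodule ℂ H) [FiniteDimensional ℂ V]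
    (hV : ∀ x ∈ V, A x ∈ V) :
    ∃ e ∈ Vᗮ, ∃ μ : ℝ, ‖e‖ = 1 ∧ 0 ≤ μ ∧ A e = (μ : ℂ) • e ∧ ∀ w ∈ Vᗮ, ‖A w‖ ≤ μ * ‖w‖ := by
  have hVo : ∀ x ∈ Vᗮ, A x ∈ Vᗮ := by
    intro x hx v hv
    rw [← hpos.inner_left_eq_inner_right]
    exact hx _ (hV v hv)
  have hne : Vᗮ ≠ ⊥ := by
    intro h
    rw [Submodule.orthogonal_eq_bot_iff] at h
    subst h
    exact hH (Module.Finite.equiv (Submodule.topEquiv (R := ℂ) (M := H)))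
  set P := Vᗮ.starProjection with hP
  set B := P ∘L A ∘L P with hB
  have hBpos : B.IsPositive := hpos.conj_starProjection Vᗮ
  have hBc : IsCompactOperator B := (hA.comp_clm P).clm_comp P
  have hBw : ∀ w ∈ Vᗮ, B w = A w := by
    intro w hw
    simp only [hB, hP, ContinuousLinearMap.comp_apply]
    rw [Submodule.starProjection_eq_self_iff.2 hw, Submodule.starProjection_eq_self_iff.2 (hVo w hw)]
  have hbound : ∀ w ∈ Vᗮ, ‖A w‖ ≤ ‖B‖ * ‖w‖ := fun w hw => by
    rw [← hBw w hw]; exact B.le_opNorm w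
  have hBmem : ∀ x, B x ∈ Vᗮ := fun x => Submodule.starProjection_apply_mem _ _
  suffices ∃ e ∈ Vᗮ, ‖e‖ = 1 ∧ A e = ((‖B‖ : ℝ) : ℂ) • e by
    obtain ⟨e, he, h1, h2⟩ := this
    exact ⟨e, he, ‖B‖, h1, norm_nonneg _, h2, hbound⟩
  obtain ⟨x, hxV, hx0, hAx⟩ : ∃ x ∈ Vᗮ, x ≠ 0 ∧ A x = ((‖B‖ : ℝ) : ℂ) • x := by
    by_cases hB0 : B = 0
    · obtain ⟨x, hx, hx0⟩ := Submodule.exists_mem_ne_zero_of_ne_bot hne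
      refine ⟨x, hx, hx0, ?_⟩
      rw [← hBw x hx, hB0]; simp
    · have hn : ((‖B‖ : ℝ) : ℂ) ≠ 0 := by simpa using hB0
      have : Nontrivial (H →L[ℂ] H) := ⟨B, 0, hB0⟩
      have hsp := CStarAlgebra.norm_mem_spectrum_of_nonneg
        (a := B) ((ContinuousLinearMap.nonneg_iff_isPositive _).2 hBpos)
      have hsp' : ((‖B‖ : ℝ) : ℂ) ∈ spectrum ℂ B := spectrum.algebraMap_mem ℂ hsp
      obtain ⟨x, hx⟩ := ((hBc.hasEigenvalue_iff_mem_spectrum hn).2 hsp').exists_hasEigenvector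
      have hBx : B x = ((‖B‖ : ℝ) : ℂ) • x := hx.apply_eq_smul
      have hxV : x ∈ Vᗮ := by
        have := Vᗮ.smul_mem (((‖B‖ : ℝ) : ℂ)⁻¹) (hBmem x)
        rwa [hBx, inv_smul_smul₀ hn] at this
      exact ⟨x, hxV, hx.2, by rw [← hBw x hxV, hBx]⟩
  refine ⟨((‖x‖⁻¹ : ℝ) : ℂ) • x, Vᗮ.smul_mem _ hxV, ?_, ?_⟩
  · rw [norm_smul]; simp [hx0]
  · rw [map_smul, hAx, smul_comm]

theorem exists_isEigenSequence (hH : ¬ FiniteDimensional ℂ H) {A : H →L[ℂ] H}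
    (hA : IsCompactOperator A) (hpos : A.IsPositive) :
    ∃ e μ, IsEigenSequence A e μ := by
  let S := {V : Submodule ℂ H // FiniteDimensional ℂ V ∧ ∀ x ∈ V, A x ∈ V}
  have step : ∀ V : S, ∃ e ∈ V.1ᗮ, ∃ μ : ℝ, ‖e‖ = 1 ∧ 0 ≤ μ ∧ A e = (μ : ℂ) • e ∧
      ∀ w ∈ V.1ᗮ, ‖A w‖ ≤ μ * ‖w‖ := fun V => by
    have := V.2.1
    exact exists_eigenvector_orthogonal hH hA hpos V.1 V.2.2
  choose e he μ h1 h0 hAe hle using step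
  let next : S → S := fun V => ⟨V.1 ⊔ Submodule.span ℂ {e V}, by
    have := V.2.1
    refine ⟨inferInstance, fun x hx => ?_⟩
    obtain ⟨y, hy, z, hz, rfl⟩ := Submodule.mem_sup.1 hx
    obtain ⟨c, rfl⟩ := Submodule.mem_span_singleton.1 hz
    rw [map_add, map_smul, hAe]
    exact add_mem (Submodule.mem_sup_left (V.2.2 y hy)) (Submodule.mem_sup_right
      (Submodule.smul_mem _ _ (Submodule.smul_mem _ _ (Submodule.mem_span_singleton_self _))))⟩
  let V : ℕ → S := fun n => Nat.rec ⟨⊥, inferInstance, by simp⟩ (fun _ W => next W) n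
  have hVs : ∀ n, (V (n + 1)).1 = (V n).1 ⊔ Submodule.span ℂ {e (V n)} := fun n => rfl
  have hVspan : ∀ n w, (∀ j < n, inner ℂ (e (V j)) w = 0) → w ∈ (V n).1ᗮ := by
    intro n
    induction n with
    | zero => intro w _; change w ∈ (⊥ : Submodule ℂ H)ᗮ; simp
    | succ n ih =>
      intro w hw
      rw [hVs, ← Submodule.inf_orthogonal]
      refine ⟨ih w fun j hj => hw j (by omega), ?_⟩
      exact Submodule.mem_orthogonal_singleton_iff_inner_right.2 (hw n (by omega))
  have hmono : Monotone fun n => (V n).1 := monotone_nat_of_le_succ fun n => by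
    rw [hVs]; exact le_sup_left
  have hlt : ∀ i j, i < j → inner ℂ (e (V i)) (e (V j)) = 0 := by
    intro i j hij
    refine he (V j) _ (hmono (Nat.succ_le_of_lt hij) ?_)
    change _ ∈ (V (i + 1)).1
    rw [hVs]
    exact Submodule.mem_sup_right (Submodule.mem_span_singleton_self _)
  refine ⟨fun n => e (V n), fun n => μ (V n), ⟨fun n => h1 _, fun i j hij => ?_⟩,
    fun n => h0 _, fun n => hAe _, fun n w hw => hle _ w (hVspan n w hw)⟩
  rcases lt_or_gt_of_ne hij with h | h
  · exact hlt i j h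
  · exact inner_eq_zero_symm.1 (hlt j i h)

namespace IsEigenSequence

variable {A : H →L[ℂ] H} {e : ℕ → H} {μ : ℕ → ℝ}

theorem norm_apply (h : IsEigenSequence A e μ) (n : ℕ) : ‖A (e n)‖ = μ n := by
  rw [h.apply_eq, norm_smul, h.orthonormal.1 n]; simp [abs_of_nonneg (h.nonneg n)]

theorem antitone (h : IsEigenSequence A e μ) : Antitone μ := by
  refine antitone_nat_of_succ_le fun n => ?_
  have := h.norm_le n (e (n + 1)) fun j hj => h.orthonormal.2 (by omega)
  rwa [h.norm_apply, h.orthonormal.1, mul_one] at this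

/-- A positive limit `ε` would make the `A (e n)` orthogonal of norm at least `ε`, leaving no Cauchy
subsequence. -/
theorem tendsto_zero (h : IsEigenSequence A e μ) (hA : IsCompactOperator A) :
    Filter.Tendsto μ Filter.atTop (nhds 0) := by
  have hbdd : BddBelow (Set.range μ) := ⟨0, by rintro _ ⟨n, rfl⟩; exact h.nonneg n⟩
  have ht := tendsto_atTop_ciInf h.antitone hbdd
  set ε := ⨅ n, μ n
  have hle : ∀ n, ε ≤ μ n := fun n => ciInf_le hbdd n
  suffices ε = 0 by rwa [this] at ht
  by_contra hne
  have hε : 0 < ε := lt_of_le_of_ne (le_ciInf h.nonneg) (Ne.symm hne)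
  obtain ⟨K, hK, hKs⟩ :=
    IsCompactOperator.image_closedBall_subset_compact (f := (A : H →ₗ[ℂ] H)) hA 1
  obtain ⟨x, -, φ, hφ, hx⟩ := hK.tendsto_subseq (x := fun n => A (e n)) fun n =>
    hKs ⟨e n, by simp [h.orthonormal.1 n], rfl⟩
  obtain ⟨N, hN⟩ := Metric.cauchySeq_iff'.1 hx.cauchySeq ε hε
  have h1 := hN (N + 1) (by omega)
  simp only [Function.comp, dist_eq_norm] at h1
  have hne' : φ N ≠ φ (N + 1) := (hφ (Nat.lt_succ_self N)).ne
  have h2 : ‖A (e (φ (N + 1))) - A (e (φ N))‖ ^ 2 = μ (φ (N + 1)) ^ 2 + μ (φ N) ^ 2 := by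
    have h0 : inner ℂ (A (e (φ (N + 1)))) (A (e (φ N))) = 0 := by
      rw [h.apply_eq, h.apply_eq, inner_smul_left, inner_smul_right, h.orthonormal.2 hne'.symm]
      simp
    rw [@norm_sub_sq ℂ, h0, h.norm_apply, h.norm_apply]; simp
  have h3 := hle (φ N)
  have h4 := pow_lt_pow_left₀ h1 (norm_nonneg _) two_ne_zero
  nlinarith [sq_nonneg (μ (φ (N + 1)))]

theorem le_rank (h : IsEigenSequence A e μ) {k : ℕ} {t : ℝ} (ht : t ≤ μ k) :
    ((k + 1 : ℕ) : Cardinal) ≤ Module.rank ℂ (upperEigenspace A t) := by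
  have hmem : ∀ i : Fin (k + 1), e i ∈ upperEigenspace A t := fun i => by
    refine Submodule.mem_iSup_of_mem (μ i) (Submodule.mem_iSup_of_mem
      (ht.trans (h.antitone (by omega))) ?_)
    rw [Module.End.mem_eigenspace_iff]
    exact h.apply_eq i
  have hli : LinearIndependent ℂ fun i : Fin (k + 1) => (⟨e i, hmem i⟩ : upperEigenspace A t) := by
    refine LinearIndependent.of_comp (upperEigenspace A t).subtype ?_
    exact h.orthonormal.linearIndependent.comp (fun i : Fin (k + 1) => (i : ℕ)) Fin.val_injective
  simpa using hli.cardinal_lift_le_rank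

/-- Both components of an eigenvector along `V ⊕ Vᗮ` satisfy the same eigenvalue equation. On `Vᗮ`
the operator is bounded by `μ k < s`, so that component vanishes. -/
theorem upperEigenspace_le (h : IsEigenSequence A e μ) (hA : A.IsPositive) {k : ℕ} {t : ℝ}
    (ht : μ k < t) :
    upperEigenspace A t ≤ Submodule.span ℂ (Set.range fun i : Fin k => e i) := by
  refine iSup₂_le fun s hs x hx => ?_
  have hx' : A x = (s : ℂ) • x := Module.End.mem_eigenspace_iff.1 hx
  set V := Submodule.span ℂ (Set.range fun i : Fin k => e i) with hV
  have hAV : ∀ v ∈ V, A v ∈ V := by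
    intro v hv
    induction hv using Submodule.span_induction with
    | mem v hv =>
      obtain ⟨i, rfl⟩ := hv
      simp only [h.apply_eq]
      exact V.smul_mem _ (Submodule.subset_span ⟨i, rfl⟩)
    | zero => simp
    | add u v _ _ hu hv => rw [map_add]; exact V.add_mem hu hv
    | smul c v _ hv => rw [map_smul]; exact V.smul_mem c hv
  have : FiniteDimensional ℂ V := FiniteDimensional.span_of_finite ℂ (Set.finite_range _)
  have hAVo : ∀ y ∈ Vᗮ, A y ∈ Vᗮ := by
    intro y hy v hv
    rw [← hA.inner_left_eq_inner_right]
    exact hy _ (hAV v hv)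
  obtain ⟨v, hv, y, hy, rfl⟩ := V.exists_add_mem_mem_orthogonal x
  have hsum : A v - (s : ℂ) • v = -(A y - (s : ℂ) • y) := by
    rw [map_add, smul_add] at hx'
    rw [← sub_eq_zero]
    rw [← sub_eq_zero] at hx'
    rw [← hx']; abel
  have hy0 : A y - (s : ℂ) • y = 0 := by
    have h1 : A y - (s : ℂ) • y ∈ Vᗮ := Vᗮ.sub_mem (hAVo y hy) (Vᗮ.smul_mem _ hy)
    have h2 : A y - (s : ℂ) • y ∈ V := by
      rw [← neg_mem_iff, ← hsum]
      exact V.sub_mem (hAV v hv) (V.smul_mem _ hv)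
    exact inner_self_eq_zero.1 (h1 _ h2)
  have hle := h.norm_le k y fun j hj =>
    hy _ (Submodule.subset_span ⟨(⟨j, hj⟩ : Fin k), rfl⟩)
  have h0 := h.nonneg k
  rw [sub_eq_zero.1 hy0, norm_smul, Complex.norm_real, Real.norm_of_nonneg (by linarith)] at hle
  have hyn : ‖y‖ = 0 := by
    by_contra hne
    have : 0 < ‖y‖ := lt_of_le_of_ne (norm_nonneg _) (Ne.symm hne)
    nlinarith
  rw [norm_eq_zero.1 hyn, add_zero]
  exact hv

theorem eigenvalueSeq_eq (h : IsEigenSequence A e μ) (hA : A.IsPositive) (k : ℕ) :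
    eigenvalueSeq A k = μ k := by
  refine IsGreatest.csSup_eq ⟨⟨h.nonneg k, h.le_rank le_rfl⟩, fun t ht => ?_⟩
  by_contra! hlt
  have h1 := ht.2.trans (Submodule.rank_mono (h.upperEigenspace_le hA hlt))
  have : FiniteDimensional ℂ (Submodule.span ℂ (Set.range fun i : Fin k => e i)) :=
    FiniteDimensional.span_of_finite ℂ (Set.finite_range _)
  rw [← Module.finrank_eq_rank, Nat.cast_le] at h1
  have h2 := h1.trans (finrank_range_le_card fun i : Fin k => e i)
  rw [Fintype.card_fin] at h2
  omega

end IsEigenSequence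

/-! ### Ky Fan's maximum principle -/

/-- Pairwise orthogonal vectors of norm at most one. -/
structure IsSubOrthonormal (u : ℕ → H) : Prop where
  norm_le_one : ∀ i, ‖u i‖ ≤ 1
  inner_eq_zero : ∀ i j, i ≠ j → inner ℂ (u i) (u j) = 0

theorem _root_.Orthonormal.isSubOrthonormal {e : ℕ → H} (he : Orthonormal ℂ e) :
    IsSubOrthonormal e :=
  ⟨fun i => (he.1 i).le, fun _ _ hij => he.2 hij⟩

theorem norm_sum_sq_of_orthogonal {u : ℕ → H} (s : Finset ℕ)
    (hu : ∀ i j, i ≠ j → inner ℂ (u i) (u j) = 0) :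
    ‖∑ i ∈ s, u i‖ ^ 2 = ∑ i ∈ s, ‖u i‖ ^ 2 := by
  induction s using Finset.cons_induction with
  | empty => simp
  | cons a s ha ih =>
    have h0 : inner ℂ (u a) (∑ i ∈ s, u i) = 0 := by
      rw [inner_sum]
      exact Finset.sum_eq_zero fun i hi => hu _ _ fun h => ha (h ▸ hi)
    rw [Finset.sum_cons, Finset.sum_cons, @norm_add_sq ℂ, h0, ih]
    simp

namespace IsSubOrthonormal

variable {u : ℕ → H}

theorem norm_sum_smul_sq_le (hu : IsSubOrthonormal u) (s : Finset ℕ) (c : ℕ → ℂ) :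
    ‖∑ i ∈ s, c i • u i‖ ^ 2 ≤ ∑ i ∈ s, ‖c i‖ ^ 2 := by
  rw [norm_sum_sq_of_orthogonal s fun i j hij => by
    rw [inner_smul_left, inner_smul_right, hu.inner_eq_zero i j hij]; simp]
  refine Finset.sum_le_sum fun i _ => ?_
  rw [norm_smul]
  exact pow_le_pow_left₀ (by positivity)
    (mul_le_of_le_one_right (norm_nonneg _) (hu.norm_le_one i)) 2

/-- Bessel's inequality. -/
theorem sum_norm_inner_sq_le (hu : IsSubOrthonormal u) (s : Finset ℕ) (x : H) :
    ∑ i ∈ s, ‖inner ℂ (u i) x‖ ^ 2 ≤ ‖x‖ ^ 2 := by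
  have h1 := hu.norm_sum_smul_sq_le s fun i => inner ℂ (u i) x
  set y := ∑ i ∈ s, inner ℂ (u i) x • u i with hy
  have h2 : RCLike.re (inner ℂ x y) = ∑ i ∈ s, ‖inner ℂ (u i) x‖ ^ 2 := by
    rw [hy, inner_sum, map_sum]
    refine Finset.sum_congr rfl fun i _ => ?_
    rw [inner_smul_right, ← inner_conj_symm x (u i), RCLike.mul_conj]
    norm_cast
  have h3 := @norm_sub_sq ℂ _ _ _ _ x y
  rw [h2] at h3
  nlinarith [sq_nonneg ‖x - y‖]

/-- `∑ |⟨u_k, f⟩| |⟨e, v_k⟩| ≤ 1` for vectors `f`, `e` in the unit ball. -/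
theorem re_sum_inner_mul_inner_le_one {v : ℕ → H} (hu : IsSubOrthonormal u)
    (hv : IsSubOrthonormal v) {f e : H} (hf : ‖f‖ ≤ 1) (he : ‖e‖ ≤ 1) (s : Finset ℕ) :
    (∑ k ∈ s, inner ℂ e (v k) * inner ℂ (u k) f).re ≤ 1 := by
  have h1 := hu.sum_norm_inner_sq_le s f
  have h2 := hv.sum_norm_inner_sq_le s e
  have hf2 : ‖f‖ ^ 2 ≤ 1 := pow_le_one₀ (norm_nonneg _) hf
  have he2 : ‖e‖ ^ 2 ≤ 1 := pow_le_one₀ (norm_nonneg _) he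
  have h3 : (∑ k ∈ s, inner ℂ e (v k) * inner ℂ (u k) f).re ≤
      ∑ k ∈ s, (‖inner ℂ (u k) f‖ ^ 2 + ‖inner ℂ (v k) e‖ ^ 2) / 2 := by
    rw [Complex.re_sum]
    refine Finset.sum_le_sum fun k _ => (Complex.re_le_norm _).trans ?_
    rw [norm_mul, norm_inner_symm e]
    nlinarith [sq_nonneg (‖inner ℂ (u k) f‖ - ‖inner ℂ (v k) e‖)]
  rw [← Finset.sum_div, Finset.sum_add_distrib] at h3
  linarith

end IsSubOrthonormal

/-- The vectors `a e_j / μ_j`, the images of the `e_j` under the polar part of `a`. -/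
def polarSeq (a : H →L[ℂ] H) (e : ℕ → H) (μ : ℕ → ℝ) (j : ℕ) : H :=
  ((μ j : ℂ)⁻¹) • a (e j)

namespace IsEigenSequence

variable {a : H →L[ℂ] H} {e : ℕ → H} {μ : ℕ → ℝ}

theorem smul_polarSeq (h : IsEigenSequence (CFC.abs a) e μ) (j : ℕ) :
    (μ j : ℂ) • polarSeq a e μ j = a (e j) := by
  by_cases h0 : μ j = 0
  · have := h.norm_apply j
    rw [norm_abs_apply, h0, norm_eq_zero] at this
    rw [h0, this]; simp
  · rw [polarSeq, smul_inv_smul₀ (by exact_mod_cast h0)]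

theorem inner_map_eq_zero (h : IsEigenSequence (CFC.abs a) e μ) {j : ℕ} {w : H}
    (hw : inner ℂ (e j) w = 0) : inner ℂ (a (e j)) (a w) = 0 := by
  have hpos := (ContinuousLinearMap.nonneg_iff_isPositive _).1 (CFC.abs_nonneg a)
  rw [← inner_abs_abs, h.apply_eq, inner_smul_left, ← hpos.inner_left_eq_inner_right, h.apply_eq,
    inner_smul_left, hw]
  simp

/-- Orthonormality fails in general: since `0⁻¹ = 0`, the vector is zero where `μ j = 0`. -/
theorem isSubOrthonormal_polarSeq (h : IsEigenSequence (CFC.abs a) e μ) :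
    IsSubOrthonormal (polarSeq a e μ) := by
  refine ⟨fun i => ?_, fun i j hij => ?_⟩
  · rw [polarSeq, norm_smul, ← norm_abs_apply, h.norm_apply, norm_inv, Complex.norm_real,
      Real.norm_of_nonneg (h.nonneg i)]
    exact inv_mul_le_one
  · rw [polarSeq, polarSeq, inner_smul_left, inner_smul_right,
      h.inner_map_eq_zero (h.orthonormal.2 hij)]
    simp

theorem sum_inner_polarSeq (h : IsEigenSequence (CFC.abs a) e μ) (n : ℕ) :
    (∑ k ∈ Finset.range n, inner ℂ (polarSeq a e μ k) (a (e k))).re =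
      ∑ k ∈ Finset.range n, μ k := by
  rw [Complex.re_sum]
  refine Finset.sum_congr rfl fun k _ => ?_
  have h1 : inner ℂ (a (e k)) (a (e k)) = (μ k : ℂ) * μ k := by
    rw [← inner_abs_abs, h.apply_eq, inner_smul_left, inner_smul_right,
      inner_self_eq_one_of_norm_eq_one (h.orthonormal.1 k), Complex.conj_ofReal, mul_one]
  rw [polarSeq, inner_smul_left, h1, map_inv₀, Complex.conj_ofReal]
  by_cases h0 : (μ k : ℂ) = 0
  · have : μ k = 0 := by exact_mod_cast h0
    rw [this]; simp
  · rw [inv_mul_cancel_left₀ h0, Complex.ofReal_re]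

/-- Lowering the first `n` singular values to `μ n` leaves an operator of norm at most `μ n`: it is
`μ n` times a contraction on the span of the first `e j`, and bounded by `μ n` on the complement,
with orthogonal images. -/
theorem norm_sub_sum_le (h : IsEigenSequence (CFC.abs a) e μ) (n : ℕ) (x : H) :
    ‖a x - ∑ j ∈ Finset.range n,
      (((μ j - μ n : ℝ) : ℂ) * inner ℂ (e j) x) • polarSeq a e μ j‖ ≤ μ n * ‖x‖ := by
  set f := polarSeq a e μ with hf
  set p := ∑ j ∈ Finset.range n, inner ℂ (e j) x • e j with hp
  set w := x - p with hw
  have hwe : ∀ j < n, inner ℂ (e j) w = 0 := by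
    intro j hj
    rw [hw, inner_sub_right, hp, h.orthonormal.inner_right_sum _ (Finset.mem_range.2 hj), sub_self]
  set q := ∑ j ∈ Finset.range n, inner ℂ (e j) x • f j with hq
  have hBx : a x - ∑ j ∈ Finset.range n, (((μ j - μ n : ℝ) : ℂ) * inner ℂ (e j) x) • f j =
      (μ n : ℂ) • q + a w := by
    have : a p = ∑ j ∈ Finset.range n, ((μ j : ℂ) * inner ℂ (e j) x) • f j := by
      rw [hp, map_sum]
      refine Finset.sum_congr rfl fun j _ => ?_
      rw [map_smul, ← h.smul_polarSeq j, smul_smul, mul_comm]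
    rw [hw, map_sub, this, hq, Finset.smul_sum]
    simp only [Complex.ofReal_sub, sub_mul, sub_smul, Finset.sum_sub_distrib, smul_smul]
    abel
  have hqw : inner ℂ ((μ n : ℂ) • q) (a w) = 0 := by
    rw [inner_smul_left, hq, sum_inner, Finset.sum_eq_zero, mul_zero]
    intro j hj
    rw [inner_smul_left, hf, polarSeq, inner_smul_left,
      h.inner_map_eq_zero (hwe j (Finset.mem_range.1 hj))]
    simp
  have hpw : inner ℂ p w = 0 := by
    rw [hp, sum_inner]
    refine Finset.sum_eq_zero fun j hj => ?_
    rw [inner_smul_left, hwe j (Finset.mem_range.1 hj), mul_zero]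
  have hx : ‖x‖ ^ 2 = ‖p‖ ^ 2 + ‖w‖ ^ 2 := by
    have : x = p + w := by rw [hw]; abel
    rw [this, @norm_add_sq ℂ, hpw]; simp
  have hpn : ‖q‖ ^ 2 ≤ ‖p‖ ^ 2 := by
    have hp2 : ‖p‖ ^ 2 = ∑ j ∈ Finset.range n, ‖inner ℂ (e j) x‖ ^ 2 := by
      rw [hp, norm_sum_sq_of_orthogonal (u := fun j => inner ℂ (e j) x • e j) _ fun i j hij => by
        rw [inner_smul_left, inner_smul_right, h.orthonormal.2 hij]; simp]
      simp only [norm_smul, h.orthonormal.1, mul_one]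
    rw [hp2]
    exact h.isSubOrthonormal_polarSeq.norm_sum_smul_sq_le _ _
  have haw : ‖a w‖ ≤ μ n * ‖w‖ := by
    rw [← norm_abs_apply]; exact h.norm_le n w hwe
  have haw2 := pow_le_pow_left₀ (norm_nonneg _) haw 2
  have h0 := h.nonneg n
  refine le_of_sq_le_sq ?_ (by positivity)
  rw [hBx, @norm_add_sq ℂ, hqw, norm_smul, Complex.norm_real, Real.norm_of_nonneg h0, mul_pow,
    mul_pow, hx]
  rw [mul_pow] at haw2
  have := mul_le_mul_of_nonneg_left hpn (sq_nonneg (μ n))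
  simp only [map_zero, mul_zero, add_zero]
  linarith

/-- Ky Fan's maximum principle, upper bound. -/
theorem re_sum_inner_le (h : IsEigenSequence (CFC.abs a) e μ) {u v : ℕ → H}
    (hu : IsSubOrthonormal u) (hv : IsSubOrthonormal v) (n : ℕ) :
    (∑ k ∈ Finset.range n, inner ℂ (u k) (a (v k))).re ≤ ∑ k ∈ Finset.range n, μ k := by
  set f := polarSeq a e μ with hf
  set r : ℕ → H := fun k => a (v k) - ∑ j ∈ Finset.range n,
      (((μ j - μ n : ℝ) : ℂ) * inner ℂ (e j) (v k)) • f j with hr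
  have hr_le : ∀ k, (inner ℂ (u k) (r k)).re ≤ μ n := by
    intro k
    have h1 : ‖r k‖ ≤ μ n * ‖v k‖ := h.norm_sub_sum_le n (v k)
    have h2 : μ n * ‖v k‖ ≤ μ n := mul_le_of_le_one_right (h.nonneg n) (hv.norm_le_one k)
    calc (inner ℂ (u k) (r k)).re ≤ ‖inner ℂ (u k) (r k)‖ := Complex.re_le_norm _
      _ ≤ ‖u k‖ * ‖r k‖ := norm_inner_le_norm _ _
      _ ≤ ‖r k‖ := mul_le_of_le_one_left (norm_nonneg _) (hu.norm_le_one k)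
      _ ≤ μ n := h1.trans h2
  -- The remainder contributes at most `n * μ n` and the finite-rank part at most `∑ (μ j - μ n)`;
  -- these add up to `∑ μ j`.
  have hsplit : ∑ k ∈ Finset.range n, inner ℂ (u k) (a (v k)) =
      ∑ k ∈ Finset.range n, inner ℂ (u k) (r k) + ∑ j ∈ Finset.range n,
        ((μ j - μ n : ℝ) : ℂ) *
          ∑ k ∈ Finset.range n, inner ℂ (e j) (v k) * inner ℂ (u k) (f j) := by
    simp only [Finset.mul_sum]
    rw [Finset.sum_comm, ← Finset.sum_add_distrib]
    refine Finset.sum_congr rfl fun k _ => ?_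
    simp only [hr, inner_sub_right, inner_sum, inner_smul_right, mul_assoc]
    ring
  have h1 : ∑ k ∈ Finset.range n, (inner ℂ (u k) (r k)).re ≤ ∑ k ∈ Finset.range n, μ n :=
    Finset.sum_le_sum fun k _ => hr_le k
  have h2 : ∑ j ∈ Finset.range n, (((μ j - μ n : ℝ) : ℂ) *
      ∑ k ∈ Finset.range n, inner ℂ (e j) (v k) * inner ℂ (u k) (f j)).re ≤
      ∑ j ∈ Finset.range n, (μ j - μ n) := by
    refine Finset.sum_le_sum fun j hj => ?_
    rw [Complex.re_ofReal_mul]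
    exact mul_le_of_le_one_right (sub_nonneg.2 (h.antitone (Finset.mem_range.1 hj).le))
      (hu.re_sum_inner_mul_inner_le_one hv (h.isSubOrthonormal_polarSeq.norm_le_one j)
        (h.orthonormal.1 j).le _)
  rw [hsplit, Complex.add_re, Complex.re_sum, Complex.re_sum]
  rw [Finset.sum_sub_distrib] at h2
  linarith

/-- Ky Fan's inequality for the sums of the largest singular values. -/
theorem sum_le_sum_add {b : H →L[ℂ] H} {e' e'' : ℕ → H} {μ' μ'' : ℕ → ℝ}
    (hab : IsEigenSequence (CFC.abs (a + b)) e μ) (ha : IsEigenSequence (CFC.abs a) e' μ')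
    (hb : IsEigenSequence (CFC.abs b) e'' μ'') (n : ℕ) :
    ∑ k ∈ Finset.range n, μ k ≤ ∑ k ∈ Finset.range n, (μ' k + μ'' k) := by
  have hu := hab.isSubOrthonormal_polarSeq
  have hv := hab.orthonormal.isSubOrthonormal
  rw [← hab.sum_inner_polarSeq n, Finset.sum_add_distrib]
  simp only [add_apply, inner_add_right, Finset.sum_add_distrib, Complex.add_re]
  exact add_le_add (ha.re_sum_inner_le hu hv n) (hb.re_sum_inner_le hu hv n)

end IsEigenSequence

/-! ### Summation by parts and the triangle inequality -/

theorem sum_tsub_eq {α : ℕ → ℝ≥0} (hmono : Monotone α) (h0 : α 0 = 0) (n : ℕ) :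
    ∑ k ∈ Finset.range n, (α (k + 1) - α k) = α n := by
  rw [Finset.sum_range_tsub hmono, h0, tsub_zero]

theorem tsum_ite_sub_eq {μ : ℕ → ℝ} (hμ : Antitone μ)
    (ht : Filter.Tendsto μ Filter.atTop (nhds 0)) (i : ℕ) :
    ∑' k, (if i ≤ k then ENNReal.ofReal (μ k - μ (k + 1)) else 0) = ENNReal.ofReal (μ i) := by
  have hpart : ∀ N, ∑ k ∈ Finset.range N,
      (if i ≤ k then ENNReal.ofReal (μ k - μ (k + 1)) else 0) =
        ENNReal.ofReal (μ i - μ (max i N)) := by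
    intro N
    induction N with
    | zero => simp
    | succ N ih =>
      rw [Finset.sum_range_succ, ih]
      split_ifs with h
      · rw [max_eq_right h, max_eq_right (by omega), ← ENNReal.ofReal_add
          (sub_nonneg.2 (hμ h)) (sub_nonneg.2 (hμ (Nat.le_succ N)))]
        congr 1; ring
      · rw [max_eq_left (by omega), max_eq_left (by omega), add_zero]
  refine tendsto_nhds_unique (ENNReal.tendsto_nat_tsum _) ?_
  simp only [hpart]
  have h1 : Filter.Tendsto (fun N => max i N) Filter.atTop Filter.atTop :=
    Filter.tendsto_atTop_mono (fun N => le_max_right i N) Filter.tendsto_id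
  simpa using ENNReal.tendsto_ofReal ((ht.comp h1).const_sub (μ i))

/-- Summation by parts: `∑ (μ_i - μ_{i+1}) α(i) = ∑ c_i μ_i`. -/
theorem tsum_sub_mul_eq {α : ℕ → ℝ≥0} (hmono : Monotone α) (h0 : α 0 = 0) {μ : ℕ → ℝ}
    (hμ : Antitone μ) (ht : Filter.Tendsto μ Filter.atTop (nhds 0)) :
    ∑' k, ENNReal.ofReal (μ k - μ (k + 1)) * (α (k + 1) : ℝ≥0∞) =
      ∑' k, ((α (k + 1) - α k : ℝ≥0) : ℝ≥0∞) * ENNReal.ofReal (μ k) := by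
  set c : ℕ → ℝ≥0∞ := fun k => ((α (k + 1) - α k : ℝ≥0) : ℝ≥0∞) with hc
  set d : ℕ → ℝ≥0∞ := fun k => ENNReal.ofReal (μ k - μ (k + 1)) with hd
  have hα : ∀ k, (α (k + 1) : ℝ≥0∞) = ∑' i, if i ≤ k then c i else 0 := by
    intro k
    rw [tsum_eq_sum (s := Finset.range (k + 1)), ← sum_tsub_eq hmono h0 (k + 1),
      ENNReal.ofNNReal_finsetSum]
    · refine Finset.sum_congr rfl fun i hi => ?_
      rw [if_pos (Nat.lt_succ_iff.1 (Finset.mem_range.1 hi))]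
    · intro i hi
      rw [if_neg]
      rw [Finset.mem_range] at hi
      omega
  calc ∑' k, d k * (α (k + 1) : ℝ≥0∞) = ∑' k, ∑' i, if i ≤ k then c i * d k else 0 := by
        refine tsum_congr fun k => ?_
        rw [hα, ← ENNReal.tsum_mul_left]
        refine tsum_congr fun i => ?_
        split_ifs <;> simp [mul_comm]
    _ = ∑' i, ∑' k, if i ≤ k then c i * d k else 0 := ENNReal.tsum_comm
    _ = ∑' i, c i * ENNReal.ofReal (μ i) := by
        refine tsum_congr fun i => ?_
        rw [← tsum_ite_sub_eq hμ ht, ← ENNReal.tsum_mul_left]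
        refine tsum_congr fun k => ?_
        split_ifs <;> simp [hd]

/-- Decreasing weights preserve inequalities between all partial sums. -/
theorem tsum_mul_le_of_sum_le {c : ℕ → ℝ≥0} (hc : Antitone c) {x y : ℕ → ℝ}
    (hx : ∀ k, 0 ≤ x k) (hy : ∀ k, 0 ≤ y k)
    (hxy : ∀ n, ∑ k ∈ Finset.range n, x k ≤ ∑ k ∈ Finset.range n, y k) :
    ∑' k, (c k : ℝ≥0∞) * ENNReal.ofReal (x k) ≤ ∑' k, (c k : ℝ≥0∞) * ENNReal.ofReal (y k) := by
  -- Abel summation as an induction: replacing `c n` by the smaller `c (n + 1)` only lowers the left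
  -- side, the difference of partial sums being nonnegative.
  have key : ∀ n, (c n : ℝ) * (∑ k ∈ Finset.range n, y k - ∑ k ∈ Finset.range n, x k) ≤
      ∑ k ∈ Finset.range n, (c k : ℝ) * y k - ∑ k ∈ Finset.range n, (c k : ℝ) * x k := by
    intro n
    induction n with
    | zero => simp
    | succ n ih =>
      have h1 : (c (n + 1) : ℝ) ≤ c n := NNReal.coe_le_coe.2 (hc n.le_succ)
      have h2 := mul_le_mul_of_nonneg_right h1 (sub_nonneg.2 (hxy (n + 1)))
      refine h2.trans ?_
      simp only [Finset.sum_range_succ]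
      linarith
  have hsum : ∀ (z : ℕ → ℝ), (∀ k, 0 ≤ z k) → ∀ n,
      ∑ k ∈ Finset.range n, (c k : ℝ≥0∞) * ENNReal.ofReal (z k) =
        ENNReal.ofReal (∑ k ∈ Finset.range n, (c k : ℝ) * z k) := by
    intro z hz n
    rw [ENNReal.ofReal_sum_of_nonneg (f := fun k => (c k : ℝ) * z k)
      fun k _ => mul_nonneg (c k).coe_nonneg (hz k)]
    refine Finset.sum_congr rfl fun k _ => ?_
    rw [ENNReal.ofReal_mul (c k).coe_nonneg, ENNReal.ofReal_coe_nnreal]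
  refine ENNReal.tsum_le_of_sum_range_le fun n => ?_
  refine le_trans ?_ (ENNReal.sum_le_tsum (Finset.range n))
  rw [hsum x hx, hsum y hy]
  refine ENNReal.ofReal_le_ofReal (sub_nonneg.1 (le_trans ?_ (key n)))
  exact mul_nonneg (c n).coe_nonneg (sub_nonneg.2 (hxy n))

theorem IsEigenSequence.choquetTrace_eq {A : H →L[ℂ] H} {e : ℕ → H} {μ : ℕ → ℝ}
    (h : IsEigenSequence A e μ) (hA : A.IsPositive)
    (ht : Filter.Tendsto μ Filter.atTop (nhds 0)) {α : ℕ → ℝ≥0} (hmono : Monotone α)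
    (h0 : α 0 = 0) :
    choquetTrace α A = ∑' k, ((α (k + 1) - α k : ℝ≥0) : ℝ≥0∞) * ENNReal.ofReal (μ k) := by
  rw [← tsum_sub_mul_eq hmono h0 h.antitone ht, choquetTrace]
  simp only [h.eigenvalueSeq_eq hA]

/-- The triangle inequality for decreasing increments. -/
theorem choquetNorm_add_le (hH : ¬ FiniteDimensional ℂ H) {α : ℕ → ℝ≥0} (hmono : Monotone α)
    (h0 : α 0 = 0) (hα : Antitone fun k => α (k + 1) - α k) {a b : H →L[ℂ] H}
    (ha : IsCompactOperator a) (hb : IsCompactOperator b) :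
    choquetNorm α (a + b) ≤ choquetNorm α a + choquetNorm α b := by
  have hpos : ∀ x : H →L[ℂ] H, (CFC.abs x).IsPositive := fun x =>
    (ContinuousLinearMap.nonneg_iff_isPositive _).1 (CFC.abs_nonneg x)
  have hab : IsCompactOperator (a + b) := ha.add hb
  obtain ⟨e, μ, h⟩ := exists_isEigenSequence hH (isCompactOperator_abs hab) (hpos _)
  obtain ⟨e', μ', h'⟩ := exists_isEigenSequence hH (isCompactOperator_abs ha) (hpos _)
  obtain ⟨e'', μ'', h''⟩ := exists_isEigenSequence hH (isCompactOperator_abs hb) (hpos _)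
  rw [choquetNorm, choquetNorm, choquetNorm,
    h.choquetTrace_eq (hpos _) (h.tendsto_zero (isCompactOperator_abs hab)) hmono h0,
    h'.choquetTrace_eq (hpos _) (h'.tendsto_zero (isCompactOperator_abs ha)) hmono h0,
    h''.choquetTrace_eq (hpos _) (h''.tendsto_zero (isCompactOperator_abs hb)) hmono h0,
    ← ENNReal.tsum_add]
  simp only [← mul_add, ← ENNReal.ofReal_add (h'.nonneg _) (h''.nonneg _)]
  exact tsum_mul_le_of_sum_le hα h.nonneg (fun k => add_nonneg (h'.nonneg k) (h''.nonneg k))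
    (h.sum_le_sum_add h' h'')

/-! ### Diagonal operators and the converse -/

/-- The finite-rank operator with eigenvectors `e_j` and eigenvalues `μ_j`, `j < N`. -/
def diagOp (e : ℕ → H) (μ : ℕ → ℝ) (N : ℕ) : H →L[ℂ] H :=
  ∑ j ∈ Finset.range N, (μ j : ℂ) • InnerProductSpace.rankOne ℂ (e j) (e j)

theorem diagOp_apply (e : ℕ → H) (μ : ℕ → ℝ) (N : ℕ) (x : H) :
    diagOp e μ N x = ∑ j ∈ Finset.range N, ((μ j : ℂ) * inner ℂ (e j) x) • e j := by
  simp [diagOp, sum_apply, mul_smul]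

theorem isCompactOperator_diagOp (e : ℕ → H) (μ : ℕ → ℝ) (N : ℕ) :
    IsCompactOperator (diagOp e μ N) := by
  induction N with
  | zero => simpa [diagOp] using isCompactOperator_zero
  | succ N ih =>
    rw [diagOp, Finset.sum_range_succ]
    refine ih.add (IsCompactOperator.smul ?_ (μ N : ℂ))
    have h1 : IsCompactOperator (ContinuousLinearMap.id ℂ ℂ) :=
      isCompactOperator_id_iff_locallyCompactSpace.2 inferInstance
    exact (h1.comp_clm (innerSL ℂ (e N))).clm_comp (ContinuousLinearMap.toSpanSingleton ℂ (e N))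

open scoped ComplexOrder in
theorem isPositive_diagOp (e : ℕ → H) {μ : ℕ → ℝ} (hμ : ∀ j, 0 ≤ μ j) (N : ℕ) :
    (diagOp e μ N).IsPositive :=
  ContinuousLinearMap.isPositive_sum _ fun j _ =>
    (InnerProductSpace.isPositive_rankOne_self (e j)).smul_of_nonneg
      (Complex.zero_le_real.2 (hμ j))

theorem isEigenSequence_diagOp {e : ℕ → H} (he : Orthonormal ℂ e) {μ : ℕ → ℝ}
    (hμ : Antitone μ) {N : ℕ} (hN : ∀ j, N ≤ j → μ j = 0) :
    IsEigenSequence (diagOp e μ N) e μ := by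
  have hnn : ∀ j, 0 ≤ μ j := fun j => (hN (max N j) (le_max_left _ _)).ge.trans
    (hμ (le_max_right _ _))
  refine ⟨he, hnn, fun n => ?_, fun n w hw => ?_⟩
  · rw [diagOp_apply]
    rcases lt_or_ge n N with h | h
    · rw [Finset.sum_eq_single_of_mem n (Finset.mem_range.2 h) fun j _ hj => by
        rw [he.2 hj]; simp]
      rw [inner_self_eq_one_of_norm_eq_one (he.1 n), mul_one]
    · rw [hN n h, Finset.sum_eq_zero fun j hj => by
        rw [he.2 ((Finset.mem_range.1 hj).trans_le h).ne]; simp]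
      simp
  · refine le_of_sq_le_sq ?_ (mul_nonneg (hnn n) (norm_nonneg _))
    rw [diagOp_apply, mul_pow]
    refine (he.isSubOrthonormal.norm_sum_smul_sq_le _ _).trans ?_
    refine le_trans ?_ (mul_le_mul_of_nonneg_left
      (he.isSubOrthonormal.sum_norm_inner_sq_le (Finset.range N) w) (sq_nonneg (μ n)))
    rw [Finset.mul_sum]
    refine Finset.sum_le_sum fun j _ => ?_
    rcases lt_or_ge j n with h | h
    · simp [hw j h]
    · rw [norm_mul, mul_pow, Complex.norm_real, Real.norm_of_nonneg (hnn j)]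
      exact mul_le_mul_of_nonneg_right (pow_le_pow_left₀ (hnn j) (hμ h) 2) (sq_nonneg _)

theorem choquetNorm_diagOp {e : ℕ → H} (he : Orthonormal ℂ e) {μ : ℕ → ℝ} (hμ : Antitone μ)
    {N : ℕ} (hN : ∀ j, N ≤ j → μ j = 0) {α : ℕ → ℝ≥0} (hmono : Monotone α) (h0 : α 0 = 0) :
    choquetNorm α (diagOp e μ N) =
      ∑' k, ((α (k + 1) - α k : ℝ≥0) : ℝ≥0∞) * ENNReal.ofReal (μ k) := by
  have h := isEigenSequence_diagOp he hμ hN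
  have hpos := isPositive_diagOp e h.nonneg N
  rw [choquetNorm, CFC.abs_of_nonneg _ ((ContinuousLinearMap.nonneg_iff_isPositive _).2 hpos)]
  refine h.choquetTrace_eq hpos ?_ hmono h0
  exact tendsto_atTop_of_eventually_const (i₀ := N) hN

/-- The indicator of `{0, …, n - 1}`. -/
def initialIndicator (n k : ℕ) : ℝ := if k < n then 1 else 0

theorem initialIndicator_nonneg (n k : ℕ) : 0 ≤ initialIndicator n k := by
  unfold initialIndicator; split_ifs <;> norm_num

theorem antitone_initialIndicator (n : ℕ) : Antitone (initialIndicator n) := by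
  intro i j hij
  unfold initialIndicator
  split_ifs <;> first | omega | norm_num

theorem initialIndicator_eq_zero {n k : ℕ} (h : n ≤ k) : initialIndicator n k = 0 :=
  if_neg h.not_gt

theorem initialIndicator_eq_one {n k : ℕ} (h : k < n) : initialIndicator n k = 1 :=
  if_pos h

theorem tsum_mul_initialIndicator {α : ℕ → ℝ≥0} (hmono : Monotone α) (h0 : α 0 = 0) (n : ℕ) :
    ∑' k, ((α (k + 1) - α k : ℝ≥0) : ℝ≥0∞) * ENNReal.ofReal (initialIndicator n k) = α n := by
  rw [tsum_eq_sum (s := Finset.range n), ← sum_tsub_eq hmono h0 n, ENNReal.ofNNReal_finsetSum]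
  · refine Finset.sum_congr rfl fun k hk => ?_
    rw [initialIndicator_eq_one (Finset.mem_range.1 hk), ENNReal.ofReal_one, mul_one]
  · intro k hk
    rw [initialIndicator_eq_zero (not_lt.1 (mt Finset.mem_range.2 hk)), ENNReal.ofReal_zero,
      mul_zero]

/-- For orthonormal `e` the summands are projections sharing `e 0, …, e (n - 1)`; one adds `e n`,
the other `e (n + 1)`. Writing the eigenvalues of the sum as two indicators makes its norm split as
`α n + α (n + 2)`. -/
theorem diagOp_add_diagOp_swap (e : ℕ → H) (n : ℕ) :
    diagOp e (initialIndicator (n + 1)) (n + 1) +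
        diagOp (e ∘ Equiv.swap n (n + 1)) (initialIndicator (n + 1)) (n + 1) =
      diagOp e (fun k => initialIndicator n k + initialIndicator (n + 2) k) (n + 2) := by
  ext x
  rw [add_apply]
  simp only [diagOp_apply, Finset.sum_range_succ, Function.comp, Equiv.swap_apply_left]
  have h1 : ∑ j ∈ Finset.range n, ((initialIndicator (n + 1) j : ℂ) *
      inner ℂ (e (Equiv.swap n (n + 1) j)) x) • e (Equiv.swap n (n + 1) j) =
      ∑ j ∈ Finset.range n, inner ℂ (e j) x • e j := by
    refine Finset.sum_congr rfl fun j hj => ?_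
    have := Finset.mem_range.1 hj
    rw [Equiv.swap_apply_of_ne_of_ne (by omega) (by omega), initialIndicator_eq_one (by omega)]
    simp
  have h2 : ∑ j ∈ Finset.range n, ((initialIndicator (n + 1) j : ℂ) * inner ℂ (e j) x) • e j =
      ∑ j ∈ Finset.range n, inner ℂ (e j) x • e j := by
    refine Finset.sum_congr rfl fun j hj => ?_
    have := Finset.mem_range.1 hj
    rw [initialIndicator_eq_one (by omega)]
    simp
  have h3 : ∑ j ∈ Finset.range n, (((initialIndicator n j + initialIndicator (n + 2) j : ℝ) : ℂ) *
      inner ℂ (e j) x) • e j =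
      ∑ j ∈ Finset.range n, inner ℂ (e j) x • e j + ∑ j ∈ Finset.range n, inner ℂ (e j) x • e j := by
    rw [← Finset.sum_add_distrib]
    refine Finset.sum_congr rfl fun j hj => ?_
    have := Finset.mem_range.1 hj
    rw [initialIndicator_eq_one this, initialIndicator_eq_one (by omega), ← add_smul]
    congr 1
    push_cast
    ring
  rw [h1, h2, h3]
  rw [initialIndicator_eq_one (by omega : n < n + 1), initialIndicator_eq_one (by omega : n < n + 2),
    initialIndicator_eq_one (by omega : n + 1 < n + 2), initialIndicator_eq_zero (le_refl n),
    initialIndicator_eq_zero (by omega : n ≤ n + 1)]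
  simp only [zero_add, Complex.ofReal_one, one_mul]
  abel

/-- Midpoint concavity follows from the triangle inequality for two projections of equal rank. -/
theorem add_le_of_choquetNorm_add_le (hH : ¬ FiniteDimensional ℂ H) {α : ℕ → ℝ≥0}
    (hmono : Monotone α) (h0 : α 0 = 0)
    (h : ∀ a b : H →L[ℂ] H, IsCompactOperator a → IsCompactOperator b →
      choquetNorm α (a + b) ≤ choquetNorm α a + choquetNorm α b) (n : ℕ) :
    α n + α (n + 2) ≤ α (n + 1) + α (n + 1) := by
  -- The zero operator serves only to produce an infinite orthonormal sequence.
  obtain ⟨e, _, he'⟩ := exists_isEigenSequence hH (A := 0) isCompactOperator_zero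
    ContinuousLinearMap.isPositive_zero
  have he := he'.orthonormal
  have hanti := antitone_initialIndicator (n + 1)
  have hzero : ∀ j, n + 1 ≤ j → initialIndicator (n + 1) j = 0 := fun j => initialIndicator_eq_zero
  have hle := h _ _ (isCompactOperator_diagOp e (initialIndicator (n + 1)) (n + 1))
    (isCompactOperator_diagOp (e ∘ Equiv.swap n (n + 1)) (initialIndicator (n + 1)) (n + 1))
  rw [diagOp_add_diagOp_swap, choquetNorm_diagOp he hanti hzero hmono h0,
    choquetNorm_diagOp (he.comp _ (Equiv.injective _)) hanti hzero hmono h0,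
    tsum_mul_initialIndicator hmono h0,
    choquetNorm_diagOp he ((antitone_initialIndicator n).add (antitone_initialIndicator (n + 2)))
      (fun j hj => by
        rw [initialIndicator_eq_zero (by omega), initialIndicator_eq_zero hj,
          add_zero]) hmono h0] at hle
  simp only [mul_add, ENNReal.ofReal_add (initialIndicator_nonneg _ _)
    (initialIndicator_nonneg _ _)] at hle
  rw [ENNReal.tsum_add, tsum_mul_initialIndicator hmono h0, tsum_mul_initialIndicator hmono h0]
    at hle
  exact_mod_cast hle

end ChoquetTrace

end

theorem mainTheorem7 {H : Type*} [NormedAddCommGroup H] [InnerProductSpace ℂ H] [CompleteSpace H]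
    [TopologicalSpace.SeparableSpace H] (hH : ¬ FiniteDimensional ℂ H)
    (α : ℕ → ℝ≥0) (hmono : Monotone α) (h0 : α 0 = 0) (h1 : 0 < α 1) :
    List.TFAE
      [ChoquetTrace.IsConcaveSeq α,
       AntitoneOn (ChoquetTrace.increment α) (Set.Ici 1),
       ∀ a b : H →L[ℂ] H, IsCompactOperator a → IsCompactOperator b →
         ChoquetTrace.choquetNorm α (a + b) ≤
           ChoquetTrace.choquetNorm α a + ChoquetTrace.choquetNorm α b] := by
  tfae_have 1 → 2 := by
    intro h
    -- The shift by one removes the truncated subtraction `i - 1`.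
    have hanti : Antitone fun k => ChoquetTrace.increment α (k + 1) := by
      refine antitone_nat_of_succ_le fun k => ?_
      have := h (k + 1) (by omega)
      simp only [ChoquetTrace.increment, Nat.add_sub_cancel] at this ⊢
      linarith
    intro i hi j hj hij
    obtain ⟨i, rfl⟩ := Nat.exists_eq_add_of_le' hi
    obtain ⟨j, rfl⟩ := Nat.exists_eq_add_of_le' hj
    exact hanti (by omega : i ≤ j)
  tfae_have 2 → 3 := by
    intro h a b ha hb
    refine ChoquetTrace.choquetNorm_add_le hH hmono h0 (fun i j hij => ?_) ha hb
    have := h (Set.mem_Ici.2 (by omega : 1 ≤ i + 1)) (Set.mem_Ici.2 (by omega : 1 ≤ j + 1))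
      (by omega)
    simp only [ChoquetTrace.increment, Nat.add_sub_cancel] at this
    rw [← NNReal.coe_le_coe, NNReal.coe_sub (hmono i.le_succ), NNReal.coe_sub (hmono j.le_succ)]
    exact this
  tfae_have 3 → 1 := by
    intro h i hi
    obtain ⟨n, rfl⟩ := Nat.exists_eq_add_of_le' hi
    have := ChoquetTrace.add_le_of_choquetNorm_add_le hH hmono h0 h n
    rw [← NNReal.coe_le_coe] at this
    push_cast at this
    simp only [Nat.add_sub_cancel]
    linarith
  tfae_finish
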